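/- Let $(X,T)$ be a topological dynamical system, that is, $X$ is a nonempty compact metric space with metric $d$ and $T\colon X\to X$ is continuous. Call a point $x\in X$ transitive if its orbit $\{T^n x : n\ge 0\}$ is dense in $X$; the system is transitive if it has a transitive point, and minimal if every point of $X$ is transitive. The system is weakly mean equicontinuous if for every $\varepsilon>0$ there is $\delta>0$ such that for all $x,y\in X$ with $d(x,y)<\delta$, $$\limsup_{n\to\infty}\ \inf_{\sigma\in S_n}\frac1n\sum_{k=1}^{n} d\bigl(T^kx,T^{\sigma(k)}y\bigr)<\varepsilon,$$ where $S_n$ is the set of all permutations of $\{1,\dots,n\}$. Let $M(X,T)$ be the set of $T$-invariant regular Borel probability measures on $X$, for $\mu\in M(X,T)$ let $\operatorname{supp}(\mu)=\{x\in X:\mu(U)>0\text{ for every neighborhood }U\text{ of }x\}$, and let $$\operatorname{supp}(X,T)=\overline{\bigcup\{\operatorname{supp}(\mu):\mu\in M(X,T)\}}.$$ Let $(X,T)$ be a transitive and weakly mean equicontinuous topological dynamical system. Then $(X,T)$ is minimal if and only if $\operatorname{supp}(X,T)=X$. -/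

import Mathlib

open MeasureTheory Filter Topology

noncomputable section

namespace WeakMean

/-- The minimal average distance, over all permutations `σ` of `{1, …, n}`, between the orbit
segments `T x, …, T ^ n x` and `T y, …, T ^ n y`; the indices `1, …, n` are written `i + 1` with
`i : Fin n`. The infimum is over a finite nonempty set of reals. -/
def permAverage {X : Type*} [MetricSpace X] (T : X → X) (n : ℕ) (x y : X) : ℝ :=
  ⨅ σ : Equiv.Perm (Fin n),
    (1 / (n : ℝ)) * ∑ i : Fin n, dist (T^[(i : ℕ) + 1] x) (T^[(σ i : ℕ) + 1] y)

/-- The weak mean pseudometric. On a compact space the averages lie in `[0, diam X]`, so this is a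
genuine upper limit. -/
def weakMeanDist {X : Type*} [MetricSpace X] (T : X → X) (x y : X) : ℝ :=
  limsup (fun n : ℕ => permAverage T n x y) atTop

/-- Weak mean equicontinuity of the system `(X, T)`. -/
def IsWeaklyMeanEquicontinuous {X : Type*} [MetricSpace X] (T : X → X) : Prop :=
  ∀ ε : ℝ, 0 < ε → ∃ δ : ℝ, 0 < δ ∧ ∀ x y : X, dist x y < δ → weakMeanDist T x y < ε

/-- A transitive point: its forward orbit `{x, T x, T ^ 2 x, …}` is dense. -/
def IsTransitivePoint {X : Type*} [TopologicalSpace X] (T : X → X) (x : X) : Prop :=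
  closure (Set.range fun n : ℕ => T^[n] x) = Set.univ

/-- The system has a transitive point. -/
def IsTransitive {X : Type*} [TopologicalSpace X] (T : X → X) : Prop :=
  ∃ x : X, IsTransitivePoint T x

/-- Every point is a transitive point. -/
def IsMinimal {X : Type*} [TopologicalSpace X] (T : X → X) : Prop :=
  ∀ x : X, IsTransitivePoint T x

/-- The set `M(X, T)` of `T`-invariant regular Borel probability measures (for a Borel
sigma-algebra on `X`). -/
def invariantMeasures {X : Type*} [TopologicalSpace X] [MeasurableSpace X] (T : X → X) :
    Set (Measure X) :=
  {μ | IsProbabilityMeasure μ ∧ μ.Regular ∧ MeasurePreserving T μ μ}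

/-- The support of the system: the closure of the union of the supports of its invariant
measures. -/
def systemSupport {X : Type*} [TopologicalSpace X] [MeasurableSpace X] (T : X → X) : Set X :=
  closure (⋃ μ ∈ invariantMeasures T, μ.support)

end WeakMean

end

/-!
Minimality implies full support because an invariant measure `μ` exists (Krylov–Bogoliubov: a
cluster point of the empirical measures along an orbit, which exists because the probability
measures on a compact metric space form a compact space), and the support of `μ` is nonempty,
closed and forward invariant, hence contains the closure of an orbit.

For the converse, the permutation average between the orbits of `x` and `y` dominates the
difference of the Birkhoff averages at `T x` and `T y` of every `1`-Lipschitz function `f`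
(`dist_birkhoffAverage_le_permAverage`). The orbit of a transitive point `x` comes arbitrarily
close to any point `y`, and moving along an orbit does not change Birkhoff averages asymptotically,
so weak mean equicontinuity makes the Birkhoff averages of `f` at `x` and at `y` asymptotically
equal (`tendsto_birkhoffAverage_sub_of_isTransitivePoint`). Suppose that the orbit of `y` misses a
nonempty open set `U`, and let `f` be the distance to the complement of `U`. The averages of `f`
vanish at `y`, hence tend to `0` at every point, hence `∫ f ∂μ = 0` and `μ U = 0` for every
invariant measure `μ`: no support of an invariant measure meets `U`.
-/

namespace WeakMean

section Topological

lemma tendsto_birkhoffAverage_iterate_sub {α : Type*} {T : α → α} {f : α → ℝ}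
    (hf : Bornology.IsBounded (Set.range f)) (m : ℕ) (x : α) :
    Tendsto (fun n ↦ birkhoffAverage ℝ T f n (T^[m] x) - birkhoffAverage ℝ T f n x)
      atTop (𝓝 0) := by
  induction m with
  | zero => simp
  | succ m ih =>
    have h := (tendsto_birkhoffAverage_apply_sub_birkhoffAverage' ℝ hf T (T^[m] x)).add ih
    simpa [Function.iterate_succ_apply'] using h

variable {X : Type*} [MetricSpace X] {T : X → X}

/-- Reindexing the orbit of `y` by a permutation does not change its Birkhoff average, so each
permutation gives a bound, and so does the infimum. -/
lemma dist_birkhoffAverage_le_permAverage {f : X → ℝ} (hf : LipschitzWith 1 f) (n : ℕ) (x y : X) :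
    dist (birkhoffAverage ℝ T f n (T x)) (birkhoffAverage ℝ T f n (T y)) ≤
      permAverage T n x y := by
  have key : ∀ z : X, birkhoffSum T f n (T z) = ∑ i : Fin n, f (T^[(i : ℕ) + 1] z) := fun z ↦ by
    simp only [birkhoffSum, ← Function.iterate_succ_apply]
    exact (Fin.sum_univ_eq_sum_range (fun k ↦ f (T^[k + 1] z)) n).symm
  refine le_ciInf fun σ ↦ ?_
  rw [dist_birkhoffAverage_birkhoffAverage, div_eq_inv_mul, one_div, key, key,
    ← Equiv.sum_comp σ fun i : Fin n ↦ f (T^[(i : ℕ) + 1] y)]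
  gcongr
  refine (dist_sum_sum_le _ _ _).trans (Finset.sum_le_sum fun i _ ↦ ?_)
  simpa using hf.dist_le_mul _ _

lemma permAverage_le_diam [CompactSpace X] (n : ℕ) (x y : X) :
    permAverage T n x y ≤ Metric.diam (Set.univ : Set X) := by
  refine (ciInf_le (Set.finite_range _).bddBelow 1).trans ?_
  rw [one_div, inv_mul_eq_div]
  refine div_le_of_le_mul₀ n.cast_nonneg Metric.diam_nonneg ?_
  refine (Finset.sum_le_card_nsmul _ _ _ fun i _ ↦ Metric.dist_le_diam_of_mem
    isCompact_univ.isBounded (Set.mem_univ _) (Set.mem_univ _)).trans ?_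
  simp [mul_comm]

lemma eventually_permAverage_lt [CompactSpace X] {x y : X} {ε : ℝ} (h : weakMeanDist T x y < ε) :
    ∀ᶠ n in atTop, permAverage T n x y < ε :=
  eventually_lt_of_limsup_lt h
    (isBoundedUnder_of ⟨_, fun n ↦ permAverage_le_diam n x y⟩)

/-- In a weakly mean equicontinuous system the Birkhoff averages of a Lipschitz function at an
arbitrary point are asymptotically the same as at a transitive point. -/
lemma tendsto_birkhoffAverage_sub_of_isTransitivePoint [CompactSpace X]
    (hequi : IsWeaklyMeanEquicontinuous T) {x : X} (hx : IsTransitivePoint T x)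
    {f : X → ℝ} (hf : LipschitzWith 1 f) (y : X) :
    Tendsto (fun n ↦ birkhoffAverage ℝ T f n y - birkhoffAverage ℝ T f n x) atTop (𝓝 0) := by
  have hb : Bornology.IsBounded (Set.range f) := (isCompact_range hf.continuous).isBounded
  rw [Metric.tendsto_atTop']
  intro ε hε
  obtain ⟨δ, hδ, h⟩ := hequi (ε / 3) (by positivity)
  have hy : y ∈ closure (Set.range fun n : ℕ ↦ T^[n] x) := hx ▸ Set.mem_univ y
  obtain ⟨_, ⟨m, rfl⟩, hm⟩ := Metric.mem_closure_iff.1 hy δ hδ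
  have h₁ := eventually_permAverage_lt (h _ _ hm)
  have h₂ := (tendsto_birkhoffAverage_iterate_sub (T := T) hb (m + 1) x).eventually
    (Metric.ball_mem_nhds 0 (show 0 < ε / 3 by positivity))
  have h₃ := (tendsto_birkhoffAverage_iterate_sub (T := T) hb 1 y).eventually
    (Metric.ball_mem_nhds 0 (show 0 < ε / 3 by positivity))
  obtain ⟨N, hN⟩ := eventually_atTop.1 (h₁.and (h₂.and h₃))
  refine ⟨N, fun n hn ↦ ?_⟩
  obtain ⟨h₁, h₂, h₃⟩ := hN n hn.le
  have h₄ := (dist_birkhoffAverage_le_permAverage (T := T) hf n y (T^[m] x)).trans_lt h₁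
  rw [← Function.iterate_succ_apply' T m x] at h₄
  simp only [Real.dist_eq, sub_zero, Function.iterate_one] at h₂ h₃ h₄ ⊢
  rw [abs_lt] at *
  constructor <;> linarith [h₂.1, h₂.2, h₃.1, h₃.2, h₄.1, h₄.2]

lemma continuous_birkhoffAverage (hT : Continuous T) {f : X → ℝ} (hf : Continuous f) (n : ℕ) :
    Continuous (birkhoffAverage ℝ T f n) := by
  unfold birkhoffAverage birkhoffSum
  have h : ∀ k, Continuous fun z ↦ f (T^[k] z) := fun k ↦ hf.comp (hT.iterate k)
  fun_prop

end Topological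

section Measure

variable {X : Type*} [MetricSpace X] [MeasurableSpace X] [BorelSpace X] {T : X → X}

lemma integral_birkhoffAverage [CompactSpace X] {μ : Measure X} [IsFiniteMeasure μ]
    (hμ : MeasurePreserving T μ μ) (hT : Continuous T) {f : X → ℝ} (hf : Continuous f)
    {n : ℕ} (hn : n ≠ 0) :
    ∫ z, birkhoffAverage ℝ T f n z ∂μ = ∫ z, f z ∂μ := by
  have h : ∀ k, ∫ z, f (T^[k] z) ∂μ = ∫ z, f z ∂μ := fun k ↦ by
    have hk := hμ.iterate k
    conv_rhs => rw [← hk.map_eq]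
    exact (integral_map hk.measurable.aemeasurable hf.aestronglyMeasurable).symm
  have hint : ∀ k ∈ Finset.range n, Integrable (fun z ↦ f (T^[k] z)) μ := fun k _ ↦
    (hf.comp (hT.iterate k)).integrable_of_hasCompactSupport (HasCompactSupport.of_compactSpace _)
  simp only [birkhoffAverage, birkhoffSum, smul_eq_mul]
  rw [integral_const_mul, integral_finsetSum _ hint]
  simp [h, hn]

lemma integral_eq_zero_of_tendsto_birkhoffAverage [CompactSpace X] {μ : Measure X}
    [IsFiniteMeasure μ] (hμ : MeasurePreserving T μ μ) (hT : Continuous T) {f : X → ℝ}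
    (hf : Continuous f)
    (h : ∀ z, Tendsto (fun n ↦ birkhoffAverage ℝ T f n z) atTop (𝓝 0)) :
    ∫ z, f z ∂μ = 0 := by
  obtain ⟨C, hC⟩ := (isCompact_range hf).isBounded.exists_norm_le
  have hC' : ∀ z, ‖f z‖ ≤ C := fun z ↦ hC _ ⟨z, rfl⟩
  have hlim := tendsto_integral_of_dominated_convergence (μ := μ)
    (F := fun n z ↦ birkhoffAverage ℝ T f n z) (f := fun _ ↦ 0) (fun _ ↦ C)
    (fun n ↦ (continuous_birkhoffAverage hT hf n).aestronglyMeasurable)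
    (integrable_const C) (fun n ↦ ae_of_all _ fun z ↦ ?_) (ae_of_all _ h)
  · rw [integral_zero] at hlim
    refine tendsto_nhds_unique (tendsto_const_nhds.congr' ?_) hlim
    filter_upwards [eventually_ne_atTop 0] with n hn
    exact (integral_birkhoffAverage hμ hT hf hn).symm
  · rw [birkhoffAverage, norm_smul, norm_inv, Real.norm_natCast, inv_mul_eq_div]
    refine div_le_of_le_mul₀ n.cast_nonneg ((norm_nonneg _).trans (hC' z)) ?_
    refine (norm_sum_le_of_le _ fun k _ ↦ hC' _).trans ?_
    simp [mul_comm]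

/-- The empirical measure `(n + 1)⁻¹ ∑ δ_{T ^ k x}`, the sum being over `k ≤ n`; the shift from `n`
to `n + 1` makes it a probability measure for every `n`. -/
noncomputable def empiricalMeasure (T : X → X) (x : X) (n : ℕ) : ProbabilityMeasure X :=
  ⟨((n : ENNReal) + 1)⁻¹ • ∑ k ∈ Finset.range (n + 1), Measure.dirac (T^[k] x), ⟨by
    simpa using ENNReal.inv_mul_cancel (by simp) (by finiteness)⟩⟩

lemma integral_empiricalMeasure (x : X) (n : ℕ) {f : X → ℝ} (hf : Continuous f) :
    ∫ z, f z ∂(empiricalMeasure T x n : Measure X) = birkhoffAverage ℝ T f (n + 1) x := by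
  have h : ∀ k ∈ Finset.range (n + 1), Integrable f (Measure.dirac (T^[k] x)) := fun k _ ↦
    integrable_dirac' hf.stronglyMeasurable (by simp)
  simp only [empiricalMeasure, ProbabilityMeasure.coe_mk, integral_smul_measure,
    integral_finsetSum_measure h, integral_dirac, birkhoffAverage, birkhoffSum]
  simp [ENNReal.toReal_add]

/-- The **Krylov–Bogoliubov theorem** for compact metric systems. -/
theorem invariantMeasures_nonempty [CompactSpace X] [Nonempty X] (hT : Continuous T) :
    (invariantMeasures T).Nonempty := by
  obtain ⟨x⟩ := ‹Nonempty X›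
  -- An ultrafilter finer than `atTop` turns the cluster point into a limit.
  let F : Ultrafilter ℕ := Ultrafilter.of atTop
  have hF : (F : Filter ℕ) ≤ atTop := Ultrafilter.of_le atTop
  obtain ⟨μ, -, hμ⟩ := isCompact_univ.ultrafilter_le_nhds (F.map (empiricalMeasure T x)) (by simp)
  have hlim : Tendsto (empiricalMeasure T x) F (𝓝 μ) := hμ
  rw [ProbabilityMeasure.tendsto_iff_forall_integral_tendsto] at hlim
  refine ⟨μ, inferInstance, inferInstance, hT.measurable, ?_⟩
  have : IsProbabilityMeasure (Measure.map T (μ : Measure X)) :=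
    Measure.isProbabilityMeasure_map hT.aemeasurable
  refine ext_of_forall_integral_eq_of_IsFiniteMeasure fun f ↦ ?_
  rw [integral_map hT.aemeasurable f.continuous.aestronglyMeasurable]
  have h₁ := hlim f
  have h₂ := hlim (f.compContinuous ⟨T, hT⟩)
  have h₃ := (tendsto_birkhoffAverage_apply_sub_birkhoffAverage' ℝ f.isBounded_range T x).comp
    ((tendsto_add_atTop_nat 1).mono_left hF)
  refine sub_eq_zero.1 (tendsto_nhds_unique (h₂.sub h₁) (h₃.congr fun n ↦ ?_))
  rw [integral_empiricalMeasure x n f.continuous,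
    integral_empiricalMeasure x n (f.compContinuous ⟨T, hT⟩).continuous]
  simp [birkhoffAverage, birkhoffSum, ← Function.iterate_succ_apply, Function.iterate_succ_apply']

lemma mapsTo_support (hT : Continuous T) {μ : Measure X} (hμ : MeasurePreserving T μ μ) :
    Set.MapsTo T μ.support μ.support := fun y hy ↦ by
  rw [Measure.support_eq_forall_isOpen] at hy ⊢
  intro U hU hUo
  rw [← hμ.measure_preimage hUo.measurableSet.nullMeasurableSet]
  exact hy _ hU (hUo.preimage hT)

lemma support_eq_univ_of_isMinimal [CompactSpace X] (hT : Continuous T) (hmin : IsMinimal T)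
    {μ : Measure X} (hμ : MeasurePreserving T μ μ) (hμ0 : μ ≠ 0) : μ.support = Set.univ := by
  obtain ⟨y, hy⟩ := Measure.nonempty_support hμ0
  refine Set.eq_univ_of_univ_subset ?_
  rw [← hmin y]
  refine Measure.isClosed_support.closure_subset_iff.2 ?_
  rintro _ ⟨n, rfl⟩
  exact (mapsTo_support hT hμ).iterate n hy

/-- An open set missed by one orbit is null for every invariant measure. -/
lemma measure_eq_zero_of_forall_iterate_notMem [CompactSpace X] (hT : Continuous T)
    (htrans : IsTransitive T) (hequi : IsWeaklyMeanEquicontinuous T) {U : Set X} (hU : IsOpen U)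
    {y : X} (hy : ∀ n, T^[n] y ∉ U) {μ : Measure X} [IsFiniteMeasure μ]
    (hμ : MeasurePreserving T μ μ) : μ U = 0 := by
  obtain ⟨x, hx⟩ := htrans
  let f : X → ℝ := fun z ↦ Metric.infDist z Uᶜ
  have hf : LipschitzWith 1 f := Metric.lipschitz_infDist_pt _
  have hfy : ∀ n, birkhoffAverage ℝ T f n y = 0 := fun n ↦ by
    have h0 : ∀ k, f (T^[k] y) = 0 := fun k ↦ Metric.infDist_zero_of_mem (hy k)
    simp [birkhoffAverage, birkhoffSum, h0]
  have hlim : ∀ z, Tendsto (fun n ↦ birkhoffAverage ℝ T f n z) atTop (𝓝 0) := fun z ↦ by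
    simpa [hfy] using (tendsto_birkhoffAverage_sub_of_isTransitivePoint hequi hx hf z).sub
      (tendsto_birkhoffAverage_sub_of_isTransitivePoint hequi hx hf y)
  have h0 := integral_eq_zero_of_tendsto_birkhoffAverage hμ hT hf.continuous hlim
  have hpos := integral_pos_iff_support_of_nonneg (μ := μ) (f := f)
    (fun z ↦ Metric.infDist_nonneg)
    (hf.continuous.integrable_of_hasCompactSupport (HasCompactSupport.of_compactSpace _))
  rw [h0, lt_self_iff_false, false_iff, not_lt, nonpos_iff_eq_zero] at hpos
  refine measure_mono_null (fun z hz ↦ ?_) hpos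
  -- The complement of `U` contains `y`; the distance to an empty set would be the junk value `0`.
  exact ((hU.isClosed_compl.notMem_iff_infDist_pos ⟨y, hy 0⟩).1 (not_not.2 hz)).ne'

end Measure

end WeakMean

open WeakMean in
theorem lemma3p11 {X : Type*} [MetricSpace X] [CompactSpace X] [Nonempty X]
    [MeasurableSpace X] [BorelSpace X] (T : X → X) (hT : Continuous T)
    (htrans : WeakMean.IsTransitive T) (hequi : WeakMean.IsWeaklyMeanEquicontinuous T) :
    WeakMean.IsMinimal T ↔ WeakMean.systemSupport T = Set.univ := by
  refine ⟨fun hmin ↦ ?_, fun hsupp y ↦ ?_⟩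
  · obtain ⟨μ, hμ⟩ := invariantMeasures_nonempty hT
    have := hμ.1
    refine Set.eq_univ_of_univ_subset (Set.Subset.trans ?_ subset_closure)
    rw [← support_eq_univ_of_isMinimal hT hmin hμ.2.2 (IsProbabilityMeasure.ne_zero μ)]
    exact Set.subset_biUnion_of_mem (u := fun μ : Measure X ↦ μ.support) hμ
  · by_contra hy
    obtain ⟨z, hz⟩ := (Set.ne_univ_iff_exists_notMem _).1 hy
    let U : Set X := (closure (Set.range fun n : ℕ ↦ T^[n] y))ᶜ
    have hU : IsOpen U := isClosed_closure.isOpen_compl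
    have hyU : ∀ n, T^[n] y ∉ U := fun n ↦ not_not.2 (subset_closure ⟨n, rfl⟩)
    have hzs : z ∈ systemSupport T := hsupp ▸ Set.mem_univ z
    obtain ⟨w, hwU, hw⟩ := mem_closure_iff.1 hzs U hU hz
    simp only [Set.mem_iUnion] at hw
    obtain ⟨μ, hμ, hwμ⟩ := hw
    have := hμ.1
    rw [Measure.mem_support_iff_forall] at hwμ
    exact (hwμ U (hU.mem_nhds hwU)).ne'
      (measure_eq_zero_of_forall_iterate_notMem hT htrans hequi hU hyU hμ.2.2)
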